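/- Fix a set $\mathrm{Var}$ of variables, a set $A$ of actions and a signature $\Sigma$ of function symbols with finite arities. The set $\mathbb{T}(\Sigma)$ of terms with recursion is defined inductively: variables are terms; $f(t_1,\dots,t_n)$ is a term for each $n$-ary $f\in\Sigma$ and terms $t_i$; and $\langle X|S\rangle$ is a term for each recursive specification $S:V_S\to\mathbb{T}(\Sigma)$ with $X\in V_S\subseteq\mathrm{Var}$, in which the variables from $V_S$ are bound. Here $t[\sigma]$ denotes (capture-avoiding) substitution for the free variables of $t$, $T(\Sigma)$ is the set of closed terms (terms without free variables), and $\langle t|S\rangle$ is $t$ with $\langle Y|S\rangle$ substituted for each $Y\in V_S$. A closed substitution is a function $\rho:\mathrm{Var}\to T(\Sigma)$. Literals are expressions $t\xrightarrow{a}t'$ (positive) and $t\not\xrightarrow{a}$ (negative) with $t,t'\in\mathbb{T}(\Sigma)$ and $a\in A$; $t\xrightarrow{a}t'$ and $t\not\xrightarrow{a}$ deny each other. A rule $\frac{H}{\alpha}$ has a set $H$ of literals as premises and a positive literal $\alpha$ as conclusion; the left- and right-hand sides of $\alpha$ are its source and target. A transition system specification (TSS) $P$ over $\Sigma$ is a set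 of rules. $P\vdash\frac{H}{\alpha}$ means that there is a well-founded tree of literals with root $\alpha$ in which each node either is a leaf labelled by an element of $H$, or forms together with its children a substitution instance of a rule of $P$. For ordinals $\lambda$ define sets $PT^-_\lambda, CT^-_\lambda$ of closed negative literals and $PT^+_\lambda,CT^+_\lambda$ of closed positive literals as follows: $PT^-_\lambda$ consists of the closed negative literals that deny no element of $\bigcup_{\kappa<\lambda}CT^+_\kappa$; $\beta\in PT^+_\lambda$ iff $P\vdash\frac{PT^-_\lambda}{\beta}$; $CT^-_\lambda$ consists of the closed negative literals that deny no element of $PT^+_\lambda$; and $\beta\in CT^+_\lambda$ iff $P\vdash\frac{CT^-_\lambda}{\beta}$. Let $\kappa$ be a closure ordinal, i.e. $PT^-_\lambda=PT^-_\kappa$ for all $\lambda>\kappa$. The well-founded semantics of $P$ is the 3-valued transition relation $\langle CT^+,PT^+\rangle:=\langle CT^+_\kappa,PT^+_\kappa\rangle$ of certain and possible transitions. A bisimulation is a relation $\mathcal{R}$ on $T(\Sigma)$ such that, whenever $p\mathrel{\mathcal R}q$ and $a\in A$: if $(p\xrightarrow{a}p')\in CT^+$ then there is a $q'$ with $(q\xrightarrow{a}q')\in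 CT^+$ and $p'\mathrel{\mathcal R}q'$; and if $(q\xrightarrow{a}q')\in PT^+$ then there is a $p'$ with $(p\xrightarrow{a}p')\in PT^+$ and $p'\mathrel{\mathcal R}q'$. Write $p\sqsubseteq_B q$ ($q$ is a modal refinement of $p$) if $p\mathrel{\mathcal R}q$ for some bisimulation $\mathcal R$. An ntytt rule is a rule in which the right-hand sides of the positive premises are variables that are all distinct and do not occur in the source. It is an ntyxt rule if its source is a variable, and an ntyft rule if its source has the form $f(x_1,\dots,x_n)$ with distinct variables $x_i$. A TSS is in the ntyft/ntyxt format with recursion if for each recursive specification $S$, each $X\in V_S$ and each $a\in A$ it has a rule $$\frac{\langle S_X|S\rangle\xrightarrow{a}z}{\langle X|S\rangle\xrightarrow{a}z}$$ with $z$ a variable, and all its other rules are ntyft or ntyxt rules. **Theorem.** For every TSS in the ntyft/ntyxt format with recursion, the bisimulation preorder $\sqsubseteq_B$ is a lean precongruence: it is a preorder on $T(\Sigma)$, and $t[\rho]\sqsubseteq_B t[\nu]$ for every term $t\in\mathbb{T}(\Sigma)$ and all closed substitutions $\rho,\nu$ such that $\rho(x)\sqsubseteq_B\nu(x)$ for each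 $x\in\mathrm{Var}$. -/

import Mathlib

universe u v w

/-- A signature: a collection of function symbols, each with a finite arity. -/
structure Signature : Type (w + 1) where
  Sym : Type w
  arity : Sym → ℕ

/-- `Term Sg Var W` is the set `𝕋(Σ, W)` of terms with recursion over the signature `Sg` whose free
variables are drawn from `W`. The names of recursion variables are taken from `Var`.

A recursive specification with set of recursion variables `V ⊆ Var` gives a right-hand side `S Y`
for each `Y ∈ V`. In `S Y` an occurrence of a recursion variable `Z ∈ V` is written `Sum.inr Z`,
and an occurrence of a variable `x` that is not bound by this specification is written `Sum.inl x`.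
So bound and free occurrences are kept apart by the syntax, and substitution never has to rename
bound variables in order to avoid name clashes. -/
inductive Term (Sg : Signature.{w}) (Var : Type u) : Type u → Type (max (u + 1) w)
  | var {W : Type u} (x : W) : Term Sg Var W
  | op {W : Type u} (f : Sg.Sym) (args : Fin (Sg.arity f) → Term Sg Var W) : Term Sg Var W
  | recur {W : Type u} (V : Set Var) (S : V → Term Sg Var (W ⊕ V)) (X : V) : Term Sg Var W

namespace Term

variable {Sg : Signature.{w}} {Var : Type u}

/-- The set of variables that occur free in a term. -/
def vars : {W : Type u} → Term Sg Var W → Set W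
  | _, var x => {x}
  | _, op _ args => {x | ∃ i, x ∈ (args i).vars}
  | _, recur _ S _ => {x | ∃ Y, Sum.inl x ∈ (S Y).vars}

/-- Renaming of free variables. -/
def rename : {W : Type u} → Term Sg Var W → {W' : Type u} → (W → W') → Term Sg Var W'
  | _, var x, _, g => var (g x)
  | _, op f args, _, g => op f (fun i => (args i).rename g)
  | _, recur V S X, _, g => recur V (fun Y => (S Y).rename (Sum.map g id)) X

/-- `t.subst σ` is the substitution instance `t[σ]`: each free occurrence of `x` is replaced by
`σ x`. A partial substitution is one with `σ x = var x` for `x` outside its domain. -/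
def subst : {W : Type u} → Term Sg Var W → {W' : Type u} → (W → Term Sg Var W') → Term Sg Var W'
  | _, var x, _, σ => σ x
  | _, op f args, _, σ => op f (fun i => (args i).subst σ)
  | _, recur V S X, _, σ =>
      recur V (fun Y => (S Y).subst
        (Sum.elim (fun x => (σ x).rename Sum.inl) (fun Z => var (Sum.inr Z)))) X

/-- `unfold V S X` is `⟨S_X | S⟩`: the right-hand side `S_X`, with `⟨Y | S⟩` substituted for each
recursion variable `Y`. -/
def unfold {W : Type u} (V : Set Var) (S : V → Term Sg Var (W ⊕ V)) (X : V) : Term Sg Var W :=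
  (S X).subst (Sum.elim var (fun Y => recur V S Y))

end Term

/-- The set `T(Σ)` of closed terms. -/
abbrev ClosedTerm (Sg : Signature.{w}) (Var : Type u) : Type (max (u + 1) w) :=
  Term Sg Var PEmpty.{u + 1}

/-- Literals `t -a→ t'` (positive) and `t -a↛` (negative), over terms with free variables
from `W`. -/
inductive Literal (Sg : Signature.{w}) (Var : Type u) (A : Type v) (W : Type u) :
    Type (max (u + 1) v w)
  | pos (t : Term Sg Var W) (a : A) (t' : Term Sg Var W) : Literal Sg Var A W
  | neg (t : Term Sg Var W) (a : A) : Literal Sg Var A W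

namespace Literal

variable {Sg : Signature.{w}} {Var : Type u} {A : Type v} {W W' : Type u}

def subst (l : Literal Sg Var A W) (σ : W → Term Sg Var W') : Literal Sg Var A W' :=
  match l with
  | pos t a t' => pos (t.subst σ) a (t'.subst σ)
  | neg t a => neg (t.subst σ) a

/-- A closed literal, regarded as a literal over `Var`. -/
def ofClosed (l : Literal Sg Var A PEmpty.{u + 1}) : Literal Sg Var A Var :=
  l.subst (fun x => x.elim)

def IsPos : Literal Sg Var A W → Prop
  | pos _ _ _ => True
  | neg _ _ => False

def IsNeg : Literal Sg Var A W → Prop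
  | pos _ _ _ => False
  | neg _ _ => True

/-- The literals `t -a→ t'` and `t -a↛` deny each other. -/
def Denies : Literal Sg Var A W → Literal Sg Var A W → Prop
  | pos t a _, neg s b => t = s ∧ a = b
  | neg t a, pos s b _ => t = s ∧ a = b
  | _, _ => False

end Literal

/-- A transition rule, with conclusion `source -label→ target`. -/
structure Rule (Sg : Signature.{w}) (Var : Type u) (A : Type v) : Type (max (u + 1) v w) where
  premises : Set (Literal Sg Var A Var)
  source : Term Sg Var Var
  label : A
  target : Term Sg Var Var

namespace Rule

variable {Sg : Signature.{w}} {Var : Type u} {A : Type v}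

def conclusion (r : Rule Sg Var A) : Literal Sg Var A Var :=
  Literal.pos r.source r.label r.target

/-- The right-hand sides of the positive premises are variables that are all distinct and do not
occur in the source. -/
def IsNtytt (r : Rule Sg Var A) : Prop :=
  (∀ t a t', Literal.pos t a t' ∈ r.premises → ∃ y, t' = Term.var y ∧ y ∉ r.source.vars) ∧
  (∀ t a s b y, Literal.pos t a (Term.var y) ∈ r.premises →
    Literal.pos s b (Term.var y) ∈ r.premises → t = s ∧ a = b)

/-- An ntytt rule whose source is a variable. -/
def IsNtyxt (r : Rule Sg Var A) : Prop :=
  r.IsNtytt ∧ ∃ x, r.source = Term.var x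

/-- An ntytt rule whose source is `f(x₁, …, xₙ)` with distinct variables `xᵢ`. -/
def IsNtyft (r : Rule Sg Var A) : Prop :=
  r.IsNtytt ∧ ∃ (f : Sg.Sym) (x : Fin (Sg.arity f) → Var),
    Function.Injective x ∧ r.source = Term.op f (fun i => Term.var (x i))

/-- The recursion rule with premise `⟨S_X | S⟩ -a→ z` and conclusion `⟨X | S⟩ -a→ z`. -/
def recursion (V : Set Var) (S : V → Term Sg Var (Var ⊕ V)) (X : V) (a : A) (z : Var) :
    Rule Sg Var A where
  premises := {Literal.pos (Term.unfold V S X) a (Term.var z)}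
  source := Term.recur V S X
  label := a
  target := Term.var z

end Rule

/-- A transition system specification over the signature `Sg`, given by its set of rules. -/
structure TSS (Sg : Signature.{w}) (Var : Type u) (A : Type v) : Type (max (u + 1) v w) where
  rules : Set (Rule Sg Var A)

namespace TSS

variable {Sg : Signature.{w}} {Var : Type u} {A : Type v}

/-- The ntyft/ntyxt format with recursion: there is a recursion rule for every recursive
specification `S`, recursion variable `X` and action `a`, and all other rules are ntyft or ntyxt
rules. -/
def IsNtyftNtyxtWithRecursion (P : TSS Sg Var A) : Prop :=
  (∀ (V : Set Var) (S : V → Term Sg Var (Var ⊕ V)) (X : V) (a : A),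
    ∃ z, Rule.recursion V S X a z ∈ P.rules) ∧
  (∀ r ∈ P.rules, (∃ V S X a z, r = Rule.recursion V S X a z) ∨ r.IsNtyft ∨ r.IsNtyxt)

/-- `P.Provable H α` means that there is a proof of the transition rule `H / α` from `P`, i.e. a
well-founded tree of literals with root `α`, in which each node is either a leaf labelled by an
element of `H`, or is together with its children a substitution instance of a rule of `P`. -/
inductive Provable (P : TSS Sg Var A) (H : Set (Literal Sg Var A Var)) :
    Literal Sg Var A Var → Prop
  | hyp {β : Literal Sg Var A Var} : β ∈ H → Provable P H β
  | rule {r : Rule Sg Var A} (hr : r ∈ P.rules) (σ : Var → Term Sg Var Var) :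
      (∀ l ∈ r.premises, Provable P H (l.subst σ)) → Provable P H (r.conclusion.subst σ)

/-- The closed positive literals `β` for which `N / β` is provable from `P`. -/
def consequences (P : TSS Sg Var A) (N : Set (Literal Sg Var A PEmpty.{u + 1})) :
    Set (Literal Sg Var A PEmpty.{u + 1}) :=
  {β | β.IsPos ∧ P.Provable (Literal.ofClosed '' N) β.ofClosed}

/-- The closed negative literals that do not deny any literal in `B`. -/
def undenied (B : Set (Literal Sg Var A PEmpty.{u + 1})) :
    Set (Literal Sg Var A PEmpty.{u + 1}) :=
  {l | l.IsNeg ∧ ∀ β ∈ B, ¬ l.Denies β}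

/-- The set `CT⁺_o` (see `ctPos_eq` for its defining equation). -/
def ctPos (P : TSS Sg Var A) (o : Ordinal.{max (u + 1) v w}) :
    Set (Literal Sg Var A PEmpty.{u + 1}) :=
  P.consequences (undenied (P.consequences (undenied
    {β | ∃ k, ∃ _ : k < o, β ∈ ctPos P k})))
termination_by o

/-- The set `PT⁻_o`: the closed negative literals that do not deny any literal in `CT⁺_k`
with `k < o`. -/
def ptNeg (P : TSS Sg Var A) (o : Ordinal.{max (u + 1) v w}) :
    Set (Literal Sg Var A PEmpty.{u + 1}) :=
  undenied {β | ∃ k, ∃ _ : k < o, β ∈ P.ctPos k}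

/-- The set `PT⁺_o`: the closed positive literals provable from `P` under hypotheses `PT⁻_o`. -/
def ptPos (P : TSS Sg Var A) (o : Ordinal.{max (u + 1) v w}) :
    Set (Literal Sg Var A PEmpty.{u + 1}) :=
  P.consequences (P.ptNeg o)

/-- The set `CT⁻_o`: the closed negative literals that do not deny any literal in `PT⁺_o`. -/
def ctNeg (P : TSS Sg Var A) (o : Ordinal.{max (u + 1) v w}) :
    Set (Literal Sg Var A PEmpty.{u + 1}) :=
  undenied (P.ptPos o)

/-- `CT⁺_o` consists of the closed positive literals provable from `P` under hypotheses
`CT⁻_o`. -/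
theorem ctPos_eq (P : TSS Sg Var A) (o : Ordinal.{max (u + 1) v w}) :
    P.ctPos o = P.consequences (P.ctNeg o) := by
  rw [ctPos]
  rfl

theorem ptNeg_antitone (P : TSS Sg Var A) : Antitone P.ptNeg := by
  intro i j hij l hl
  refine ⟨hl.1, ?_⟩
  rintro β ⟨k, hk, hβ⟩
  exact hl.2 β ⟨k, hk.trans_le hij, hβ⟩

/-- `k` is a closure ordinal if the sets `PT⁻_o` are constant from `k` on. -/
def IsClosureOrdinal (P : TSS Sg Var A) (k : Ordinal.{max (u + 1) v w}) : Prop :=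
  ∀ o, k < o → P.ptNeg o = P.ptNeg k

theorem exists_isClosureOrdinal (P : TSS Sg Var A) : ∃ k, P.IsClosureOrdinal k := by
  let rk : Literal Sg Var A PEmpty.{u + 1} → Ordinal.{max (u + 1) v w} :=
    fun l => sInf {o | l ∉ P.ptNeg o}
  refine ⟨⨆ l, rk l, fun o ho => ?_⟩
  apply Set.Subset.antisymm (P.ptNeg_antitone ho.le)
  intro l hl
  by_contra hlo
  have h1 : l ∉ P.ptNeg (rk l) := csInf_mem (s := {o | l ∉ P.ptNeg o}) ⟨o, hlo⟩
  exact h1 (P.ptNeg_antitone (Ordinal.le_iSup rk l) hl)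

/-- A closure ordinal of `P`. -/
noncomputable def closureOrdinal (P : TSS Sg Var A) : Ordinal.{max (u + 1) v w} :=
  Classical.choose P.exists_isClosureOrdinal

/-- The certain transitions `p -a→ q`, i.e. those in `CT⁺`, of the well-founded semantics. -/
def Certain (P : TSS Sg Var A) (p : ClosedTerm Sg Var) (a : A) (q : ClosedTerm Sg Var) : Prop :=
  Literal.pos p a q ∈ P.ctPos P.closureOrdinal

/-- The possible transitions `p -a⇢ q`, i.e. those in `PT⁺`, of the well-founded semantics. -/
def Possible (P : TSS Sg Var A) (p : ClosedTerm Sg Var) (a : A) (q : ClosedTerm Sg Var) : Prop :=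
  Literal.pos p a q ∈ P.ptPos P.closureOrdinal

/-- Bisimulations on the 3-valued transition relation of `P`. -/
structure IsBisimulation (P : TSS Sg Var A)
    (R : ClosedTerm Sg Var → ClosedTerm Sg Var → Prop) : Prop where
  certain : ∀ p q a p', R p q → P.Certain p a p' → ∃ q', P.Certain q a q' ∧ R p' q'
  possible : ∀ p q a q', R p q → P.Possible q a q' → ∃ p', P.Possible p a p' ∧ R p' q'

/-- The bisimulation preorder: `q` is a modal refinement of `p`. -/
def BisimPreorder (P : TSS Sg Var A) (p q : ClosedTerm Sg Var) : Prop :=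
  ∃ R, P.IsBisimulation R ∧ R p q

end TSS

/-- A preorder on closed terms is a lean precongruence if `t[ρ] ⊑ t[ν]` for every term `t` and all
closed substitutions `ρ ⊑ ν`. -/
structure IsLeanPrecongruence {Sg : Signature.{w}} {Var : Type u}
    (r : ClosedTerm Sg Var → ClosedTerm Sg Var → Prop) : Prop where
  refl : ∀ p, r p p
  trans : ∀ p q s, r p q → r q s → r p s
  lean : ∀ (t : Term Sg Var Var) (ρ ν : Var → ClosedTerm Sg Var),
    (∀ x, r (ρ x) (ν x)) → r (t.subst ρ) (t.subst ν)

/-!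
Let `B` be a bisimulation and adjoin to the signature one constant `l` for each related pair
`(left l, right l)`. A term `t` over the new signature has a left and a right evaluation, and these
pairs of evaluations form the lean congruence closure of `B`. It suffices that it is a bisimulation,
i.e. that each transition `p -a→ p'` of a left evaluation can be lifted: to a term `t` with left
evaluation `p` one has to assign a term `Φ t` with left evaluation `p'`, such that the right
evaluations of `t` and `Φ t` are related by an `a`-transition.

The lift is constructed by induction on the proof of `p -a→ p'`. If this proof ends with an ntyft or
ntyxt rule, the premises have been lifted already, but the right-hand side of a premise may occur in
the left-hand sides of other premises, possibly circularly, as no well-foundedness of rules is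
assumed. So the values of the premise variables are the solution of a system of fixed point
equations. For this to have a solution, the lifts `Φ` are required to be monotone in the information
order, in which replacing `left l` by the constant `l` makes a term larger: terms with a fixed left
evaluation form a chain-complete partial order with least element, on which monotone maps have least
fixed points.

Negative premises are dealt with by transfinite induction on the stages of the well-founded
semantics.
-/

universe z

/-- Chain completeness of a partial order: every nonempty chain has a least upper bound. This is a
proposition, unlike `ChainCompletePartialOrder`, because it is proved by induction on terms. -/
def IsChainComplete (α : Type*) [PartialOrder α] : Prop :=
  ∀ C : Set α, C.Nonempty → IsChain (· ≤ ·) C → ∃ u, IsLUB C u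

namespace IsChainComplete

theorem of_forall_isMax {α : Type*} [PartialOrder α] (hα : ∀ a : α, IsMax a) :
    IsChainComplete α := by
  rintro C ⟨c, hc⟩ hC
  exact ⟨c, fun d hd => (hC.total hc hd).elim (fun h => hα c h) id, fun b hb => hb hc⟩

theorem pi {ι : Type*} {D : ι → Type*} [∀ i, PartialOrder (D i)]
    (hD : ∀ i, IsChainComplete (D i)) : IsChainComplete (∀ i, D i) := by
  intro C hCne hC
  choose u hu using fun i => hD i (Function.eval i '' C) (hCne.image _)
    ((Function.monotone_eval i).isChain_image hC)
  exact ⟨u, isLUB_pi.2 hu⟩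

theorem of_orderEmbedding {α β : Type*} [PartialOrder α] [OrderBot α] [PartialOrder β]
    [OrderBot β] (hα : IsChainComplete α) (e : α ↪o β) (e_bot : e ⊥ = ⊥)
    (isMax : ∀ b ∉ Set.range e, IsMax b) (eq_bot : ∀ b ∉ Set.range e, ∀ a, e a ≤ b → a = ⊥) :
    IsChainComplete β := by
  intro C hCne hC
  by_cases hCe : C ⊆ Set.range e
  · obtain ⟨C, rfl⟩ := Set.subset_range_iff_exists_image_eq.1 hCe
    obtain ⟨u, hu⟩ := hα C hCne.of_image (IsChain.image_embedding_iff.1 hC)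
    refine ⟨e u, e.monotone.mem_upperBounds_image hu.1, fun b hb => ?_⟩
    by_cases hbe : b ∈ Set.range e
    · obtain ⟨a, rfl⟩ := hbe
      exact e.monotone (hu.2 fun c hc => e.le_iff_le.1 (hb ⟨c, hc, rfl⟩))
    · have u_eq_bot : u = ⊥ :=
        le_bot_iff.1 (hu.2 fun c hc => (eq_bot b hbe c (hb ⟨c, hc, rfl⟩)).le)
      rw [u_eq_bot, e_bot]
      exact bot_le
  · obtain ⟨c, hc, hce⟩ := Set.not_subset.1 hCe
    exact ⟨c, fun d hd => (hC.total hc hd).elim (fun h => isMax c hce h) id, fun b hb => hb hc⟩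

theorem exists_least_fixedPoint {α : Type*} [PartialOrder α] [OrderBot α]
    (hα : IsChainComplete α) (f : α →o α) : ∃ x, f x = x ∧ ∀ y, f y ≤ y → x ≤ y := by
  obtain ⟨m, -, hm⟩ := zorn_le_nonempty₀ {x | x ≤ f x ∧ ∀ y, f y ≤ y → x ≤ y}
    (fun C hCs hC c hc => by
      obtain ⟨u, hu⟩ := hα C ⟨c, hc⟩ hC
      exact ⟨u, ⟨hu.2 fun z hz => (hCs hz).1.trans (f.monotone (hu.1 hz)),
        fun y hy => hu.2 fun z hz => (hCs hz).2 y hy⟩, fun z hz => hu.1 hz⟩)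
    ⊥ ⟨bot_le, fun _ _ => bot_le⟩
  have f_le : f m ≤ m :=
    hm.2 ⟨f.monotone hm.1.1, fun y hy => (f.monotone (hm.1.2 y hy)).trans hy⟩ hm.1.1
  exact ⟨m, f_le.antisymm hm.1.1, hm.1.2⟩

theorem exists_monotone_fixedPoint {α β : Type*} [PartialOrder α] [OrderBot α] [PartialOrder β]
    [OrderBot β] (hβ : IsChainComplete β) (f : α × β →o β) (f_bot : f ⊥ = ⊥) :
    ∃ T : α →o β, T ⊥ = ⊥ ∧ ∀ a, f (a, T a) = T a := by
  choose T fixed least using fun a => hβ.exists_least_fixedPoint (OrderHom.curry f a)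
  refine ⟨⟨T, fun a a' h => least a _ ?_⟩, le_bot_iff.1 (least ⊥ ⊥ f_bot.le), fixed⟩
  calc f (a, T a') ≤ f (a', T a') := f.monotone ⟨h, le_rfl⟩
    _ = T a' := fixed a'

/-- The equations `d i = G i d` for `i ∈ Y` may be circular, which is why they are solved by least
fixed points. -/
theorem exists_monotone_solution {ι : Type*} {D : ι → Type*} [∀ i, PartialOrder (D i)]
    [∀ i, OrderBot (D i)] (hD : ∀ i, IsChainComplete (D i)) {Y : Set ι}
    (G : ∀ i ∈ Y, (∀ j, D j) →o D i) (G_bot : ∀ i hi, G i hi ⊥ = ⊥) :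
    ∃ T : (∀ i, D i) →o (∀ i, D i), T ⊥ = ⊥ ∧ (∀ m, ∀ i ∉ Y, T m i = m i) ∧
      ∀ m i hi, T m i = G i hi (T m) := by
  classical
  let f : (∀ i, D i) × (∀ i, D i) →o ∀ i, D i :=
    { toFun := fun x i => if hi : i ∈ Y then G i hi x.2 else x.1 i
      monotone' := fun x x' h i => by
        by_cases hi : i ∈ Y
        · simpa only [dif_pos hi] using (G i hi).monotone h.2
        · simpa only [dif_neg hi] using h.1 i }
  have f_bot : f ⊥ = ⊥ := by
    funext i
    by_cases hi : i ∈ Y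
    · exact (dif_pos hi).trans (G_bot i hi)
    · exact dif_neg hi
  obtain ⟨T, T_bot, fixed⟩ := (pi hD).exists_monotone_fixedPoint f f_bot
  refine ⟨T, T_bot, fun m i hi => ?_, fun m i hi => ?_⟩
  · exact (congrFun (fixed m) i).symm.trans (dif_neg hi)
  · exact (congrFun (fixed m) i).symm.trans (dif_pos hi)

end IsChainComplete

namespace Term

variable {Sg : Signature.{w}} {Var : Type u} {W W' W'' : Type u}

/-- The action of a substitution below a binder of the variables from `V`, which it fixes. -/
def liftSubst (V : Set Var) (σ : W → Term Sg Var W') : W ⊕ V → Term Sg Var (W' ⊕ V) :=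
  Sum.elim (fun x => (σ x).rename Sum.inl) fun Z => var (Sum.inr Z)

theorem subst_recur (V : Set Var) (S : V → Term Sg Var (W ⊕ V)) (X : V)
    (σ : W → Term Sg Var W') :
    (recur V S X).subst σ = recur V (fun Y => (S Y).subst (liftSubst V σ)) X :=
  rfl

theorem liftSubst_var (V : Set Var) :
    liftSubst V (var : W → Term Sg Var W) = var := by
  funext z
  cases z <;> rfl

theorem rename_eq_subst (t : Term Sg Var W) (g : W → W') :
    t.rename g = t.subst fun x => var (g x) := by
  induction t generalizing W' with
  | var x => rfl
  | op f args ih => simp only [rename, subst, ih]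
  | recur V S X ih =>
    simp only [rename, subst, ih]
    congr! 3 with Y
    funext z
    cases z <;> rfl

theorem subst_rename (t : Term Sg Var W) (g : W → W') (σ : W' → Term Sg Var W'') :
    (t.rename g).subst σ = t.subst fun x => σ (g x) := by
  induction t generalizing W' W'' with
  | var x => rfl
  | op f args ih => simp only [rename, subst, ih]
  | recur V S X ih =>
    simp only [rename, subst, ih]
    congr! 3 with Y
    funext z
    cases z <;> rfl

theorem rename_rename (t : Term Sg Var W) (g : W → W') (h : W' → W'') :
    (t.rename g).rename h = t.rename (h ∘ g) := by
  rw [rename_eq_subst (t.rename g), subst_rename, rename_eq_subst]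
  rfl

theorem rename_subst (t : Term Sg Var W) (σ : W → Term Sg Var W') (g : W' → W'') :
    (t.subst σ).rename g = t.subst fun x => (σ x).rename g := by
  induction t generalizing W' W'' with
  | var x => rfl
  | op f args ih => simp only [rename, subst, ih]
  | recur V S X ih =>
    simp only [rename, subst, ih]
    congr! 3 with Y
    funext z
    cases z with
    | inl x => simp only [Sum.elim_inl, rename_rename]; rfl
    | inr Z => rfl

theorem subst_subst (t : Term Sg Var W) (σ : W → Term Sg Var W') (τ : W' → Term Sg Var W'') :
    (t.subst σ).subst τ = t.subst fun x => (σ x).subst τ := by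
  induction t generalizing W' W'' with
  | var x => rfl
  | op f args ih => simp only [subst, ih]
  | recur V S X ih =>
    simp only [subst, ih]
    congr! 3 with Y
    funext z
    cases z with
    | inl x => simp only [Sum.elim_inl, subst_rename, rename_subst]
    | inr Z => rfl

theorem subst_var (t : Term Sg Var W) : t.subst var = t := by
  induction t with
  | var x => rfl
  | op f args ih => simp only [subst, ih]
  | recur V S X ih => simp only [subst_recur, liftSubst_var, ih]

theorem subst_unfold (V : Set Var) (S : V → Term Sg Var (W ⊕ V)) (X : V)
    (σ : W → Term Sg Var W') :
    (unfold V S X).subst σ = unfold V (fun Y => (S Y).subst (liftSubst V σ)) X := by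
  simp only [unfold, subst_subst]
  congr 1
  funext z
  cases z with
  | inl x => simp only [Sum.elim_inl, subst, liftSubst, subst_rename, subst_var]
  | inr Y => rfl

/-- A closed term, regarded as a term with free variables from `W`. -/
def ofClosed (p : ClosedTerm Sg Var) : Term Sg Var W :=
  p.rename PEmpty.elim

theorem rename_ofClosed (p : ClosedTerm Sg Var) (g : W → W') :
    (ofClosed p).rename g = ofClosed p := by
  rw [ofClosed, rename_rename, Subsingleton.elim (g ∘ PEmpty.elim) PEmpty.elim, ofClosed]

theorem subst_closed (p : ClosedTerm Sg Var) (σ : PEmpty.{u + 1} → ClosedTerm Sg Var) :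
    p.subst σ = p := by
  rw [Subsingleton.elim σ var, subst_var]

theorem subst_ofClosed (p : ClosedTerm Sg Var) (σ : W → Term Sg Var W') :
    (ofClosed p).subst σ = ofClosed p := by
  rw [ofClosed, subst_rename, ofClosed, rename_eq_subst]
  congr 1
  exact Subsingleton.elim _ _

theorem ofClosed_eq_self (p : ClosedTerm Sg Var) : (ofClosed p : ClosedTerm Sg Var) = p := by
  rw [ofClosed, rename_eq_subst, subst_closed]

end Term

/-- The signature `Sg` with the elements of `L` added as constants, which serve as names of closed
terms. -/
abbrev Signature.adjoin (Sg : Signature.{w}) (L : Type z) : Signature :=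
  ⟨Sg.Sym ⊕ L, Sum.elim Sg.arity fun _ => 0⟩

namespace Term

variable {Sg : Signature.{w}} {Var : Type u} {L : Type z} {W W' : Type u}

/-- The adjoined constant `l`. -/
def const (l : L) : Term (Sg.adjoin L) Var W :=
  op (Sum.inr l) Fin.elim0

/-- Replace each adjoined constant `l` by the closed term `e l`. -/
def eval (e : L → ClosedTerm Sg Var) : {W : Type u} → Term (Sg.adjoin L) Var W → Term Sg Var W
  | _, var x => var x
  | _, op (Sum.inl f) args => op f fun i => (args i).eval e
  | _, op (Sum.inr l) _ => ofClosed (e l)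
  | _, recur V S X => recur V (fun Y => (S Y).eval e) X

/-- A term over `Sg`, regarded as a term without adjoined constants over `Sg.adjoin L`. -/
def embed (L : Type z) : {W : Type u} → Term Sg Var W → Term (Sg.adjoin L) Var W
  | _, var x => var x
  | _, op f args => op (Sum.inl f) fun i => (args i).embed L
  | _, recur V S X => recur V (fun Y => (S Y).embed L) X

@[elab_as_elim]
theorem adjoinInduction {motive : {W : Type u} → Term (Sg.adjoin L) Var W → Prop}
    (var : ∀ {W : Type u} (x : W), motive (var x))
    (const : ∀ {W : Type u} (l : L), motive (const l : Term (Sg.adjoin L) Var W))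
    (op : ∀ {W : Type u} (f : Sg.Sym) (args : Fin (Sg.arity f) → Term (Sg.adjoin L) Var W),
      (∀ i, motive (args i)) → motive (.op (Sum.inl f) args))
    (recur : ∀ {W : Type u} (V : Set Var) (S : V → Term (Sg.adjoin L) Var (W ⊕ V)) (X : V),
      (∀ Y, motive (S Y)) → motive (recur V S X))
    (t : Term (Sg.adjoin L) Var W) : motive t := by
  induction t with
  | var x => exact var x
  | op f args ih =>
    cases f with
    | inl f => exact op f args ih
    | inr l =>
      obtain rfl : args = Fin.elim0 := funext fun i => i.elim0
      exact const l
  | recur V S X ih => exact recur V S X ih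

theorem const_ne_embed (l : L) (p : Term Sg Var W) : const l ≠ p.embed L := by
  cases p <;> rintro ⟨⟩

theorem rename_const (l : L) (g : W → W') :
    (const l : Term (Sg.adjoin L) Var W).rename g = const l :=
  congrArg (op _) (Subsingleton.elim (α := Fin 0 → _) _ _)

theorem subst_const (l : L) (σ : W → Term (Sg.adjoin L) Var W') :
    (const l : Term (Sg.adjoin L) Var W).subst σ = const l :=
  congrArg (op _) (Subsingleton.elim (α := Fin 0 → _) _ _)

variable (e : L → ClosedTerm Sg Var)

theorem eval_const (l : L) : (const l : Term (Sg.adjoin L) Var W).eval e = ofClosed (e l) := by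
  simp only [const, eval]

theorem eval_embed (t : Term Sg Var W) : (t.embed L).eval e = t := by
  induction t with
  | var x => simp only [embed, eval]
  | op f args ih => simp only [embed, eval, ih]
  | recur V S X ih => simp only [embed, eval, ih]

theorem eval_rename (t : Term (Sg.adjoin L) Var W) (g : W → W') :
    (t.rename g).eval e = (t.eval e).rename g := by
  induction t using adjoinInduction generalizing W' with
  | var x => simp only [rename, eval]
  | const l => rw [rename_const, eval_const, eval_const, rename_ofClosed]
  | op f args ih => simp only [rename, eval, ih]
  | recur V S X ih => simp only [rename, eval, ih]

theorem eval_subst (t : Term (Sg.adjoin L) Var W) (σ : W → Term (Sg.adjoin L) Var W') :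
    (t.subst σ).eval e = (t.eval e).subst fun x => (σ x).eval e := by
  induction t using adjoinInduction generalizing W' with
  | var x => simp only [subst, eval]
  | const l => rw [subst_const, eval_const, eval_const, subst_ofClosed]
  | op f args ih => simp only [subst, eval, ih]
  | recur V S X ih =>
    simp only [subst, eval, ih]
    congr! 3 with Y
    funext z
    cases z with
    | inl x => simp only [Sum.elim_inl, eval_rename]
    | inr Z => simp only [Sum.elim_inr, eval]

theorem eval_unfold (V : Set Var) (S : V → Term (Sg.adjoin L) Var (W ⊕ V)) (X : V) :
    (unfold V S X).eval e = unfold V (fun Y => (S Y).eval e) X := by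
  simp only [unfold, eval_subst]
  congr 1
  funext z
  cases z <;> simp only [Sum.elim_inl, Sum.elim_inr, eval]

theorem embed_rename (t : Term Sg Var W) (g : W → W') :
    (t.rename g).embed L = (t.embed L).rename g := by
  induction t generalizing W' with
  | var x => rfl
  | op f args ih => exact congrArg (op (Sum.inl f)) (funext fun i => ih i g)
  | recur V S X ih => simp only [embed, rename, ih]

theorem embed_subst (t : Term Sg Var W) (σ : W → Term Sg Var W') :
    (t.subst σ).embed L = (t.embed L).subst fun x => (σ x).embed L := by
  induction t generalizing W' with
  | var x => rfl
  | op f args ih => exact congrArg (op (Sum.inl f)) (funext fun i => ih i σ)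
  | recur V S X ih =>
    simp only [embed, subst, ih]
    congr! 3 with Y
    funext z
    cases z with
    | inl x => simp only [Sum.elim_inl, embed_rename]
    | inr Z => rfl

theorem embed_unfold (V : Set Var) (S : V → Term Sg Var (W ⊕ V)) (X : V) :
    (unfold V S X).embed L = unfold V (fun Y => (S Y).embed L) X := by
  simp only [unfold, embed_subst]
  congr 1
  funext z
  cases z <;> rfl

theorem embed_ofClosed (p : ClosedTerm Sg Var) :
    (ofClosed p : Term Sg Var W).embed L = ofClosed (p.embed L) :=
  embed_rename p _

end Term

/-- The information order on terms with adjoined constants: `t.Le left t'` if `t` is obtained from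
`t'` by opening some of the constants `l`, i.e. replacing them by the ordinary term `left l`. -/
inductive Term.Le {Sg : Signature.{w}} {Var : Type u} {L : Type z} (left : L → ClosedTerm Sg Var) :
    {W : Type u} → Term (Sg.adjoin L) Var W → Term (Sg.adjoin L) Var W → Prop
  | var {W : Type u} (x : W) : Le left (var x) (var x)
  | const {W : Type u} (l : L) : Le left (const l : Term _ _ W) (const l)
  | opened {W : Type u} {t : Term (Sg.adjoin L) Var W} (l : L) :
      t = ofClosed ((left l).embed L) → Le left t (const l)
  | op {W : Type u} (f : Sg.Sym) {args args' : Fin (Sg.arity f) → Term (Sg.adjoin L) Var W} :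
      (∀ i, Le left (args i) (args' i)) → Le left (op (Sum.inl f) args) (op (Sum.inl f) args')
  | recur {W : Type u} {V : Set Var} {S S' : V → Term (Sg.adjoin L) Var (W ⊕ V)} (X : V) :
      (∀ Y, Le left (S Y) (S' Y)) → Le left (recur V S X) (recur V S' X)

namespace Term.Le

variable {Sg : Signature.{w}} {Var : Type u} {L : Type z} {left : L → ClosedTerm Sg Var}
  {W W' : Type u} {t t' t'' : Term (Sg.adjoin L) Var W}

theorem refl (t : Term (Sg.adjoin L) Var W) : t.Le left t := by
  induction t using adjoinInduction with
  | var x => exact var x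
  | const l => exact const l
  | op f args ih => exact op f ih
  | recur V S X ih => exact recur X ih

theorem eq_embed {p : Term Sg Var W} (h : t.Le left (p.embed L)) : t = p.embed L := by
  induction p with
  | var x =>
    cases h
    rfl
  | op f args ih =>
    cases h with
    | op _ h =>
      exact congrArg (Term.op (Sg := Sg.adjoin L) (Sum.inl f)) (funext fun i => ih i (h i))
  | recur V S X ih =>
    cases h with
    | recur _ h => exact congrArg (Term.recur V · X) (funext fun Y => ih Y (h Y))

theorem eq_const {l : L} (h : (Term.const l).Le left t) : t = Term.const l := by
  generalize hs : Term.const l = s at h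
  cases h with
  | const l' => rfl
  | opened l' h => exact absurd (hs.trans (h.trans (embed_ofClosed _).symm)) (const_ne_embed l _)
  | _ => cases hs

theorem eq_const_or_of_le_const {l : L} (h : t.Le left (Term.const l)) :
    t = Term.const l ∨ t = ofClosed ((left l).embed L) := by
  generalize hs : Term.const l = s at h
  cases h with
  | const l' => exact Or.inl rfl
  | opened l' h =>
    cases hs
    exact Or.inr h
  | _ => cases hs

theorem trans (h : t.Le left t') (h' : t'.Le left t'') : t.Le left t'' := by
  induction h' with
  | var x => exact h
  | const l => exact h
  | opened l h' =>
    rw [← embed_ofClosed] at h'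
    subst h'
    exact opened l (h.eq_embed.trans (embed_ofClosed _))
  | op f _ ih =>
    cases h with
    | op _ h => exact op f fun i => ih i (h i)
  | recur X _ ih =>
    cases h with
    | recur _ h => exact recur X fun Y => ih Y (h Y)

theorem antisymm (h : t.Le left t') (h' : t'.Le left t) : t = t' := by
  induction h with
  | var x => rfl
  | const l => rfl
  | opened l h =>
    rw [← embed_ofClosed] at h
    subst h
    exact h'.eq_embed.symm
  | op f _ ih =>
    cases h' with
    | op _ h' =>
      exact congrArg (Term.op (Sg := Sg.adjoin L) (Sum.inl f)) (funext fun i => ih i (h' i))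
  | @recur _ V _ _ X _ ih =>
    cases h' with
    | recur _ h' => exact congrArg (Term.recur V · X) (funext fun Y => ih Y (h' Y))

theorem embed_eval_left (t : Term (Sg.adjoin L) Var W) : ((t.eval left).embed L).Le left t := by
  induction t using adjoinInduction with
  | var x => exact var x
  | const l =>
    rw [eval_const, embed_ofClosed]
    exact opened l rfl
  | op f args ih => exact op f ih
  | recur V S X ih => exact recur X ih

theorem rename (h : t.Le left t') (g : W → W') : (t.rename g).Le left (t'.rename g) := by
  induction h generalizing W' with
  | var x => exact var (g x)
  | const l => exact refl _
  | opened l h =>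
    rw [h, rename_ofClosed, rename_const]
    exact opened l rfl
  | op f _ ih => exact op f fun i => ih i g
  | recur X _ ih => exact recur X fun Y => ih Y _

theorem subst {σ σ' : W → Term (Sg.adjoin L) Var W'} (h : t.Le left t')
    (hσ : ∀ x, (σ x).Le left (σ' x)) : (t.subst σ).Le left (t'.subst σ') := by
  induction h generalizing W' with
  | var x => exact hσ x
  | const l =>
    rw [subst_const, subst_const]
    exact const l
  | opened l h =>
    rw [h, subst_ofClosed, subst_const]
    exact opened l rfl
  | op f _ ih => exact op f fun i => ih i hσ
  | @recur _ V _ _ X _ ih =>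
    refine recur X fun Y => ih Y ?_
    rintro (x | Z)
    · exact (hσ x).rename _
    · exact refl _

theorem unfold {V : Set Var} {S S' : V → Term (Sg.adjoin L) Var (W ⊕ V)}
    (h : ∀ Y, (S Y).Le left (S' Y)) (X : V) : (unfold V S X).Le left (unfold V S' X) := by
  refine (h X).subst ?_
  rintro (x | Y)
  · exact refl _
  · exact recur Y h

end Term.Le

/-- The terms with adjoined constants that become `p` when every constant `l` is replaced by
`left l`, ordered by information. -/
def Fiber {Sg : Signature.{w}} {Var : Type u} {L : Type z} (left : L → ClosedTerm Sg Var)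
    {W : Type u} (p : Term Sg Var W) : Type _ :=
  {t : Term (Sg.adjoin L) Var W // t.eval left = p}

namespace Fiber

variable {Sg : Signature.{w}} {Var : Type u} {L : Type z} {left : L → ClosedTerm Sg Var}
  {W W' : Type u} {p : Term Sg Var W}

instance : PartialOrder (Fiber left p) where
  le t t' := t.1.Le left t'.1
  le_refl t := .refl t.1
  le_trans _ _ _ h h' := h.trans h'
  le_antisymm _ _ h h' := Subtype.ext (h.antisymm h')

instance : OrderBot (Fiber left p) where
  bot := ⟨p.embed L, p.eval_embed left⟩
  bot_le t := by
    obtain ⟨t, rfl⟩ := t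
    exact .embed_eval_left t

/-- The terms that are not constants. Transitions of these arise from rules, those of the constants
`l` from the relation between `left l` and its counterpart. -/
def IsProper (t : Fiber left p) : Prop :=
  ∀ l, t.1 ≠ .const l

theorem bot_isProper : (⊥ : Fiber left p).IsProper :=
  fun l h => Term.const_ne_embed l p h.symm

theorem isMax_of_not_isProper {t : Fiber left p} (ht : ¬ t.IsProper) : IsMax t := by
  obtain ⟨l, t_eq⟩ : ∃ l, t.1 = .const l := not_forall_not.1 ht
  intro t' (hle : t.1.Le left t'.1)
  have t'_eq : t' = t := Subtype.ext ((t_eq ▸ hle).eq_const.trans t_eq.symm)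
  exact t'_eq.le

theorem eq_bot_of_le {t t' : Fiber left p} (ht : t.IsProper) (ht' : ¬ t'.IsProper)
    (hle : t ≤ t') : t = ⊥ := by
  obtain ⟨l, t'_eq⟩ : ∃ l, t'.1 = .const l := not_forall_not.1 ht'
  have p_eq : p = Term.ofClosed (left l) := by rw [← t'.2, t'_eq, Term.eval_const]
  have t_le : t.1.Le left (.const l) := t'_eq ▸ hle
  refine Subtype.ext (t_le.eq_const_or_of_le_const.resolve_left (ht l) |>.trans ?_)
  rw [← Term.embed_ofClosed, ← p_eq]
  rfl

theorem eq_bot_of_isProper_var {x : W} {t : Fiber left (Term.var x)} (ht : t.IsProper) :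
    t = ⊥ := by
  obtain ⟨t, h⟩ := t
  induction t using Term.adjoinInduction with
  | var y =>
    cases h
    rfl
  | const l => exact absurd rfl (ht l)
  | op f args _ => cases h
  | recur V S X _ => cases h

/-- The terms `f(t₁, …, tₙ)` over `f(p₁, …, pₙ)`. -/
def op (f : Sg.Sym) {args : Fin (Sg.arity f) → Term Sg Var W} :
    (∀ i, Fiber left (args i)) ↪o Fiber left (Term.op f args) :=
  OrderEmbedding.ofMapLEIff
    (fun t => ⟨Term.op (Sum.inl f) fun i => (t i).1,
      congrArg (Term.op f) (funext fun i => (t i).2)⟩)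
    fun t t' => ⟨fun h => by cases h with | op _ h => exact h, fun h => .op f h⟩

theorem exists_op_eq {f : Sg.Sym} {args : Fin (Sg.arity f) → Term Sg Var W}
    {t : Fiber left (Term.op f args)} (ht : t.IsProper) : ∃ t', op f t' = t := by
  obtain ⟨t, h⟩ := t
  induction t using Term.adjoinInduction with
  | var x => cases h
  | const l => exact absurd rfl (ht l)
  | op f' args' _ =>
    cases h
    exact ⟨fun i => ⟨args' i, rfl⟩, rfl⟩
  | recur V S X _ => cases h

/-- The terms `⟨X | S'⟩` over `⟨X | S⟩`. -/
def recur {V : Set Var} {S : V → Term Sg Var (W ⊕ V)} (X : V) :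
    (∀ Y, Fiber left (S Y)) ↪o Fiber left (Term.recur V S X) :=
  OrderEmbedding.ofMapLEIff
    (fun S' => ⟨Term.recur V (fun Y => (S' Y).1) X,
      congrArg (Term.recur V · X) (funext fun Y => (S' Y).2)⟩)
    fun S' S'' => ⟨fun h => by cases h with | recur _ h => exact h, fun h => .recur X h⟩

theorem exists_recur_eq {V : Set Var} {S : V → Term Sg Var (W ⊕ V)} {X : V}
    {t : Fiber left (Term.recur V S X)} (ht : t.IsProper) : ∃ S', recur X S' = t := by
  obtain ⟨t, h⟩ := t
  induction t using Term.adjoinInduction with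
  | var x => cases h
  | const l => exact absurd rfl (ht l)
  | op f' args' _ => cases h
  | recur V S X _ =>
    cases h
    exact ⟨fun Y => ⟨S Y, rfl⟩, rfl⟩

theorem isChainComplete_of_orderEmbedding {α : Type*} [PartialOrder α] [OrderBot α]
    (hα : IsChainComplete α) (e : α ↪o Fiber left p) (e_bot : e ⊥ = ⊥)
    (proper : ∀ a, (e a).IsProper) (surj : ∀ t : Fiber left p, t.IsProper → ∃ a, e a = t) :
    IsChainComplete (Fiber left p) :=
  hα.of_orderEmbedding e e_bot (fun t ht => isMax_of_not_isProper (mt (surj t) ht))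
    fun t ht a hle => e.injective ((eq_bot_of_le (proper a) (mt (surj t) ht) hle).trans e_bot.symm)

theorem isChainComplete (p : Term Sg Var W) : IsChainComplete (Fiber left p) := by
  induction p with
  | var x =>
    exact isChainComplete_of_orderEmbedding (α := Unit) (.of_forall_isMax fun _ _ _ => le_rfl)
      (OrderEmbedding.ofMapLEIff (fun _ => ⊥) fun _ _ => ⟨fun _ => le_rfl, fun _ => le_rfl⟩) rfl
      (fun _ => bot_isProper) fun t ht => ⟨⟨⟩, (eq_bot_of_isProper_var ht).symm⟩
  | op f args ih =>
    exact isChainComplete_of_orderEmbedding (.pi ih) (op f) rfl (fun t l h => by cases h)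
      fun t => exists_op_eq
  | recur V S X ih =>
    exact isChainComplete_of_orderEmbedding (.pi ih) (recur X) rfl (fun t l h => by cases h)
      fun t => exists_recur_eq

/-- The substitution instances of an ordinary term. -/
def subst (s : Term Sg Var W) {σ : W → Term Sg Var W'} :
    (∀ x, Fiber left (σ x)) →o Fiber left (s.subst σ) where
  toFun m := ⟨(s.embed L).subst fun x => (m x).1, by
    simp only [Term.eval_subst, Term.eval_embed, (m _).2]⟩
  monotone' _ _ h := (Term.Le.refl _).subst h

theorem subst_bot (s : Term Sg Var W) {σ : W → Term Sg Var W'} :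
    subst s (⊥ : ∀ x, Fiber left (σ x)) = ⊥ :=
  Subtype.ext (Term.embed_subst s σ).symm

/-- The term obtained by replacing every constant `l` by `right l`. -/
def eval (right : L → ClosedTerm Sg Var) (t : Fiber left p) : Term Sg Var W :=
  t.1.eval right

theorem eval_subst (right : L → ClosedTerm Sg Var) (s : Term Sg Var W) {σ : W → Term Sg Var W'}
    (m : ∀ x, Fiber left (σ x)) :
    (subst s m).eval right = s.subst fun x => (m x).eval right := by
  change ((s.embed L).subst fun x => (m x).1).eval right = _
  rw [Term.eval_subst, Term.eval_embed]
  rfl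

end Fiber

/-- The shape of the sources of ntyft and ntyxt rules: a variable, or a function symbol applied to
distinct variables. -/
def Term.IsFlat {Sg : Signature.{w}} {Var : Type u} {W : Type u} (s : Term Sg Var W) : Prop :=
  (∃ x, s = var x) ∨
    ∃ (f : Sg.Sym) (x : Fin (Sg.arity f) → W), Function.Injective x ∧ s = op f fun i => var (x i)

theorem exists_pi_extension {ι κ : Type*} {D : ι → Type*} {x : κ → ι} (hx : Function.Injective x)
    (args : ∀ i, D (x i)) (d : ∀ y, D y) :
    ∃ m : ∀ y, D y, (∀ i, m (x i) = args i) ∧ ∀ y ∉ Set.range x, m y = d y := by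
  have choice (y : ι) :
      ∃ b : D y, (∀ i, x i = y → HEq b (args i)) ∧ (y ∉ Set.range x → b = d y) := by
    by_cases hy : y ∈ Set.range x
    · obtain ⟨i, rfl⟩ := hy
      refine ⟨args i, fun j hj => ?_, fun hy => absurd ⟨i, rfl⟩ hy⟩
      rw [hx hj]
    · exact ⟨d y, fun i hi => absurd ⟨i, hi⟩ hy, fun _ => rfl⟩
  choose m m_eq m_off using choice
  exact ⟨m, fun i => eq_of_heq (m_eq _ i rfl), m_off⟩

namespace Fiber

variable {Sg : Signature.{w}} {Var : Type u} {L : Type z} {left : L → ClosedTerm Sg Var}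
  {W W' : Type u} {s : Term Sg Var W} {σ : W → Term Sg Var W'}

theorem subst_le_subst_iff (hs : s.IsFlat) {m m' : ∀ x, Fiber left (σ x)} :
    subst s m ≤ subst s m' ↔ ∀ x ∈ s.vars, m x ≤ m' x := by
  rcases hs with ⟨x, rfl⟩ | ⟨f, x, -, rfl⟩
  · exact ⟨fun h _ hy => hy ▸ h, fun h => h x rfl⟩
  · calc
      _ ↔ op f (fun i => m (x i)) ≤ op f (fun i => m' (x i)) := Iff.rfl
      _ ↔ ∀ i, m (x i) ≤ m' (x i) := (op f).le_iff_le
      _ ↔ _ := ⟨fun h _ ⟨i, hi⟩ => hi ▸ h i, fun h i => h (x i) ⟨i, rfl⟩⟩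

theorem exists_subst_eq (hs : s.IsFlat) {t : Fiber left (s.subst σ)} (ht : t.IsProper) :
    ∃ m, subst s m = t ∧ ∀ x ∉ s.vars, m x = ⊥ := by
  rcases hs with ⟨x, rfl⟩ | ⟨f, x, hx, rfl⟩
  · obtain ⟨m, m_eq, m_off⟩ := exists_pi_extension
      (Function.injective_of_subsingleton fun _ : Unit => x) (fun _ => t)
      (⊥ : ∀ y, Fiber left (σ y))
    exact ⟨m, m_eq (), fun y hy => m_off y fun ⟨_, h⟩ => hy h.symm⟩
  · obtain ⟨args, rfl⟩ := exists_op_eq ht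
    obtain ⟨m, m_eq, m_off⟩ := exists_pi_extension hx args (⊥ : ∀ y, Fiber left (σ y))
    exact ⟨m, congrArg (op f) (funext m_eq), fun y hy => m_off y fun ⟨i, hi⟩ => hy ⟨i, hi.symm⟩⟩

theorem exists_monotoneOn_matching (hs : s.IsFlat) :
    ∃ M : Fiber left (s.subst σ) → ∀ x, Fiber left (σ x),
      MonotoneOn M {t | t.IsProper} ∧ M ⊥ = ⊥ ∧ ∀ t : Fiber left (s.subst σ), t.IsProper →
        subst s (M t) = t := by
  choose! M subst_M M_off using fun (t : Fiber left (s.subst σ)) (ht : t.IsProper) =>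
    exists_subst_eq hs ht
  have M_mono : MonotoneOn M {t | t.IsProper} := by
    intro t ht t' ht' hle x
    by_cases hx : x ∈ s.vars
    · rw [← subst_M t ht, ← subst_M t' ht'] at hle
      exact (subst_le_subst_iff hs).1 hle x hx
    · rw [M_off t ht x hx]
      exact bot_le
  have M_bot : M ⊥ = ⊥ := by
    have subst_eq : subst s (M ⊥) = subst s (⊥ : ∀ x, Fiber left (σ x)) :=
      (subst_M ⊥ bot_isProper).trans (subst_bot s).symm
    funext x
    by_cases hx : x ∈ s.vars
    · exact le_bot_iff.1 ((subst_le_subst_iff hs).1 subst_eq.le x hx)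
    · exact M_off ⊥ bot_isProper x hx
  exact ⟨M, M_mono, M_bot, subst_M⟩

/-- The unfoldings `⟨S'_X | S'⟩` over `⟨S_X | S⟩`. -/
def unfold {V : Set Var} {S : V → Term Sg Var (W ⊕ V)} (X : V) :
    (∀ Y, Fiber left (S Y)) →o Fiber left (Term.unfold V S X) where
  toFun S' := ⟨Term.unfold V (fun Y => (S' Y).1) X, by
    simp only [Term.eval_unfold, (S' _).2]⟩
  monotone' _ _ h := Term.Le.unfold h X

theorem unfold_bot {V : Set Var} {S : V → Term Sg Var (W ⊕ V)} (X : V) :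
    unfold X (⊥ : ∀ Y, Fiber left (S Y)) = ⊥ :=
  Subtype.ext (Term.embed_unfold V S X).symm

theorem eval_unfold (right : L → ClosedTerm Sg Var) {V : Set Var} {S : V → Term Sg Var (W ⊕ V)}
    (X : V) (S' : ∀ Y, Fiber left (S Y)) :
    (unfold X S').eval right = Term.unfold V (fun Y => (S' Y).eval right) X :=
  Term.eval_unfold right V (fun Y => (S' Y).1) X

theorem eval_recur (right : L → ClosedTerm Sg Var) {V : Set Var} {S : V → Term Sg Var (W ⊕ V)}
    (X : V) (S' : ∀ Y, Fiber left (S Y)) :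
    (recur X S').eval right = Term.recur V (fun Y => (S' Y).eval right) X := by
  change Term.eval right (Term.recur V (fun Y => (S' Y).1) X : Term (Sg.adjoin L) Var W) = _
  rw [Term.eval]
  rfl

end Fiber

namespace Literal

variable {Sg : Signature.{w}} {Var : Type u} {A : Type v}

theorem subst_subst {W W' W'' : Type u} (l : Literal Sg Var A W) (σ : W → Term Sg Var W')
    (τ : W' → Term Sg Var W'') : (l.subst σ).subst τ = l.subst fun x => (σ x).subst τ := by
  cases l <;> simp only [subst, Term.subst_subst]

theorem subst_closed (l : Literal Sg Var A PEmpty.{u + 1})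
    (σ : PEmpty.{u + 1} → ClosedTerm Sg Var) : l.subst σ = l := by
  cases l <;> simp only [subst, Term.subst_closed]

end Literal

namespace TSS

variable {Sg : Signature.{w}} {Var : Type u} {A : Type v} {P : TSS Sg Var A}
  {N N' : Set (Literal Sg Var A PEmpty.{u + 1})}

/-- Provability of closed literals by proofs that contain closed literals only. -/
inductive ClosedProvable (P : TSS Sg Var A) (N : Set (Literal Sg Var A PEmpty.{u + 1})) :
    Literal Sg Var A PEmpty.{u + 1} → Prop
  | hyp {β : Literal Sg Var A PEmpty.{u + 1}} : β ∈ N → ClosedProvable P N β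
  | rule {r : Rule Sg Var A} (hr : r ∈ P.rules) (σ : Var → ClosedTerm Sg Var) :
      (∀ l ∈ r.premises, ClosedProvable P N (l.subst σ)) →
        ClosedProvable P N (r.conclusion.subst σ)

theorem ClosedProvable.mono (hN : N ⊆ N') {l : Literal Sg Var A PEmpty.{u + 1}}
    (h : P.ClosedProvable N l) : P.ClosedProvable N' l := by
  induction h with
  | hyp h => exact .hyp (hN h)
  | rule hr σ _ ih => exact .rule hr σ ih

theorem Provable.closedProvable {l : Literal Sg Var A Var}
    (h : P.Provable (Literal.ofClosed '' N) l) (τ : Var → ClosedTerm Sg Var) :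
    P.ClosedProvable N (l.subst τ) := by
  induction h with
  | hyp h =>
    obtain ⟨l, hl, rfl⟩ := h
    rw [Literal.ofClosed, Literal.subst_subst, Literal.subst_closed]
    exact .hyp hl
  | rule hr σ _ ih =>
    rw [Literal.subst_subst]
    refine .rule hr _ fun l hl => ?_
    rw [← Literal.subst_subst]
    exact ih l hl

theorem ClosedProvable.provable {l : Literal Sg Var A PEmpty.{u + 1}}
    (h : P.ClosedProvable N l) : P.Provable (Literal.ofClosed '' N) l.ofClosed := by
  induction h with
  | hyp h => exact .hyp ⟨_, h, rfl⟩
  | rule hr σ _ ih =>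
    rw [Literal.ofClosed, Literal.subst_subst]
    refine .rule hr _ fun l hl => ?_
    rw [← Literal.subst_subst]
    exact ih l hl

theorem pos_mem_consequences {p q : ClosedTerm Sg Var} {a : A} :
    Literal.pos p a q ∈ P.consequences N ↔ P.ClosedProvable N (.pos p a q) := by
  refine ⟨fun h => ?_, fun h => ⟨trivial, h.provable⟩⟩
  have closed := h.2.closedProvable fun _ => p
  rwa [Literal.ofClosed, Literal.subst_subst, Literal.subst_closed] at closed

theorem ClosedProvable.neg_mem {p : ClosedTerm Sg Var} {a : A}
    (h : P.ClosedProvable N (.neg p a)) : .neg p a ∈ N := by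
  cases h with
  | hyp h => exact h

theorem ClosedProvable.recursion (hP : P.IsNtyftNtyxtWithRecursion) {V : Set Var}
    {S : V → Term Sg Var (PEmpty.{u + 1} ⊕ V)} {X : V} {a : A} {q : ClosedTerm Sg Var}
    (h : P.ClosedProvable N (.pos (Term.unfold V S X) a q)) :
    P.ClosedProvable N (.pos (Term.recur V S X) a q) := by
  obtain ⟨z, hz⟩ := hP.1 V (fun Y => (S Y).rename (Sum.map PEmpty.elim id)) X a
  have subst_eq : (fun Y => ((S Y).rename (Sum.map PEmpty.elim id)).subst
      (Term.liftSubst V fun _ : Var => q)) = S := by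
    funext Y
    rw [Term.subst_rename]
    refine Eq.trans (congrArg (S Y).subst (funext ?_)) (S Y).subst_var
    rintro (x | Z)
    · exact x.elim
    · rfl
  have conclusion := ClosedProvable.rule (N := N) hz (fun _ => q) (by
    rintro _ rfl
    simp only [Literal.subst, Term.subst_unfold, subst_eq]
    exact h)
  change P.ClosedProvable N (.pos ((Term.recur V _ X).subst fun _ => q) a q) at conclusion
  rwa [Term.subst_recur, subst_eq] at conclusion

/-- Every transition of some `left i` under the hypotheses `N` is matched by a transition of
`right i` under the hypotheses `N'`, the targets again being of the form `left j` and `right j`. -/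
def Simulates (P : TSS Sg Var A) (N N' : Set (Literal Sg Var A PEmpty.{u + 1})) {ι : Type*}
    (left right : ι → ClosedTerm Sg Var) : Prop :=
  ∀ i a p', P.ClosedProvable N (.pos (left i) a p') →
    ∃ j, left j = p' ∧ P.ClosedProvable N' (.pos (right i) a (right j))

end TSS

/-- `Φ` lifts a transition `p -a→ p'`, in a monotone way, to transitions of the right evaluations of
the terms in `D`. -/
structure IsLift {Sg : Signature.{w}} {Var : Type u} {A : Type v} {L : Type z}
    {left : L → ClosedTerm Sg Var} (P : TSS Sg Var A) (N : Set (Literal Sg Var A PEmpty.{u + 1}))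
    (right : L → ClosedTerm Sg Var) {p p' : ClosedTerm Sg Var} (D : Set (Fiber left p)) (a : A)
    (Φ : Fiber left p → Fiber left p') : Prop where
  monotoneOn : MonotoneOn Φ D
  map_bot : Φ ⊥ = ⊥
  provable : ∀ t ∈ D, P.ClosedProvable N (.pos (t.eval right) a ((Φ t).eval right))

section Lift

variable {Sg : Signature.{w}} {Var : Type u} {A : Type v} {L : Type z} {P : TSS Sg Var A}
  {N N' : Set (Literal Sg Var A PEmpty.{u + 1})} {left right : L → ClosedTerm Sg Var}

theorem Fiber.exists_eval_eq_of_not_isProper {p : ClosedTerm Sg Var} {t : Fiber left p}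
    (ht : ¬ t.IsProper) : ∃ l, left l = p ∧ t.eval right = right l := by
  obtain ⟨l, t_eq⟩ : ∃ l, t.1 = .const l := not_forall_not.1 ht
  have eval_eq (e : L → ClosedTerm Sg Var) : t.1.eval e = e l := by
    rw [t_eq, Term.eval_const, Term.ofClosed_eq_self]
  exact ⟨l, (eval_eq left).symm.trans t.2, eval_eq right⟩

theorem Fiber.exists_eval_eq (l : L) :
    ∃ t : Fiber left (left l), t.eval right = right l := by
  have eval_eq (e : L → ClosedTerm Sg Var) : (Term.const l).eval e = e l := by
    rw [Term.eval_const, Term.ofClosed_eq_self]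
  exact ⟨⟨.const l, eval_eq left⟩, eval_eq right⟩

theorem IsLift.exists_univ {p p' : ClosedTerm Sg Var} {a : A}
    {Φ : Fiber left p → Fiber left p'} (hΦ : IsLift P N' right {t | t.IsProper} a Φ)
    (sim : P.Simulates N N' left right) (h : P.ClosedProvable N (.pos p a p')) :
    ∃ Ψ : Fiber left p → Fiber left p', IsLift P N' right Set.univ a Ψ := by
  have lift (t : Fiber left p) : ∃ u : Fiber left p',
      P.ClosedProvable N' (.pos (t.eval right) a (u.eval right)) ∧ (t.IsProper → u = Φ t) := by
    by_cases ht : t.IsProper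
    · exact ⟨Φ t, hΦ.provable t ht, fun _ => rfl⟩
    · obtain ⟨l, rfl, t_eval⟩ := Fiber.exists_eval_eq_of_not_isProper (right := right) ht
      obtain ⟨l', rfl, h'⟩ := sim l a p' h
      obtain ⟨u, u_eval⟩ := Fiber.exists_eval_eq (left := left) (right := right) l'
      exact ⟨u, by rwa [t_eval, u_eval], fun hp => absurd hp ht⟩
  choose Ψ provable Ψ_eq using lift
  have Ψ_bot : Ψ ⊥ = ⊥ := (Ψ_eq ⊥ Fiber.bot_isProper).trans hΦ.map_bot
  refine ⟨Ψ, fun t _ t' _ hle => ?_, Ψ_bot, fun t _ => provable t⟩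
  by_cases ht : t.IsProper
  · by_cases ht' : t'.IsProper
    · rw [Ψ_eq t ht, Ψ_eq t' ht']
      exact hΦ.monotoneOn ht ht' hle
    · rw [Fiber.eq_bot_of_le ht ht' hle, Ψ_bot]
      exact bot_le
  · rw [(Fiber.isMax_of_not_isProper ht).eq_of_le hle]

theorem exists_premise_solution {H : Set (Literal Sg Var A Var)} {σ : Var → ClosedTerm Sg Var}
    (unique : ∀ t a s b y, Literal.pos t a (.var y) ∈ H → Literal.pos s b (.var y) ∈ H →
      t = s ∧ a = b)
    (lift : ∀ s b y, Literal.pos s b (.var y) ∈ H →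
      ∃ Φ : Fiber left (s.subst σ) → Fiber left (σ y), IsLift P N right Set.univ b Φ) :
    ∃ T : (∀ x, Fiber left (σ x)) →o (∀ x, Fiber left (σ x)), T ⊥ = ⊥ ∧
      (∀ m x, (∀ s b, Literal.pos s b (.var x) ∉ H) → T m x = m x) ∧
      ∀ m s b y, Literal.pos s b (.var y) ∈ H → P.ClosedProvable N
        (.pos (s.subst fun x => (T m x).eval right) b ((T m y).eval right)) := by
  let Y : Set Var := {y | ∃ s b, Literal.pos s b (.var y) ∈ H}
  choose s b mem using fun (y : Var) (hy : y ∈ Y) => hy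
  choose Φ hΦ using fun y hy => lift _ _ y (mem y hy)
  let G (y : Var) (hy : y ∈ Y) : (∀ x, Fiber left (σ x)) →o Fiber left (σ y) :=
    ⟨fun m => Φ y hy (Fiber.subst (s y hy) m), fun _ _ h =>
      (hΦ y hy).monotoneOn trivial trivial ((Fiber.subst (s y hy)).monotone h)⟩
  have G_bot (y : Var) (hy : y ∈ Y) : G y hy ⊥ = ⊥ :=
    (congrArg (Φ y hy) (Fiber.subst_bot (s y hy))).trans (hΦ y hy).map_bot
  obtain ⟨T, T_bot, T_off, T_eq⟩ :=
    IsChainComplete.exists_monotone_solution (fun x => Fiber.isChainComplete (σ x)) G G_bot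
  refine ⟨T, T_bot, fun m x hx => T_off m x fun ⟨s, b, h⟩ => hx s b h, fun m s' b' y h => ?_⟩
  have hy : y ∈ Y := ⟨s', b', h⟩
  obtain ⟨rfl, rfl⟩ := unique _ _ _ _ y (mem y hy) h
  rw [← Fiber.eval_subst, T_eq m y hy]
  exact (hΦ y hy).provable _ trivial

theorem exists_isLift_of_isNtytt {r : Rule Sg Var A} (hr : r ∈ P.rules) (ntytt : r.IsNtytt)
    (flat : r.source.IsFlat) {σ : Var → ClosedTerm Sg Var}
    (lift : ∀ s b y, Literal.pos s b (.var y) ∈ r.premises →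
      ∃ Φ : Fiber left (s.subst σ) → Fiber left (σ y), IsLift P N right Set.univ b Φ)
    (neg_mem : ∀ s b, Literal.neg s b ∈ r.premises → ∀ t : Fiber left (s.subst σ),
      .neg (t.eval right) b ∈ N) :
    ∃ Φ : Fiber left (r.source.subst σ) → Fiber left (r.target.subst σ),
      IsLift P N right {t | t.IsProper} r.label Φ := by
  obtain ⟨M, M_mono, M_bot, subst_M⟩ := Fiber.exists_monotoneOn_matching (left := left)
    (σ := σ) flat
  obtain ⟨T, T_bot, T_off, solution⟩ := exists_premise_solution ntytt.2 lift
  have T_source (m : ∀ x, Fiber left (σ x)) :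
      Fiber.subst r.source (T m) = Fiber.subst r.source m := by
    have T_eq : ∀ x ∈ r.source.vars, T m x = m x := by
      refine fun x hx => T_off m x fun s b h => ?_
      obtain ⟨y, y_eq, hy⟩ := ntytt.1 s b _ h
      cases y_eq
      exact hy hx
    exact le_antisymm ((Fiber.subst_le_subst_iff flat).2 fun x hx => (T_eq x hx).le)
      ((Fiber.subst_le_subst_iff flat).2 fun x hx => (T_eq x hx).ge)
  refine ⟨fun t => Fiber.subst r.target (T (M t)), ⟨?_, ?_, fun t ht => ?_⟩⟩
  · exact ((Fiber.subst r.target).comp T).monotone.comp_monotoneOn M_mono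
  · rw [M_bot, T_bot, Fiber.subst_bot]
  · have source_eq : Fiber.subst r.source (T (M t)) = t := (T_source _).trans (subst_M t ht)
    rw [Fiber.eval_subst]
    nth_rewrite 1 [← source_eq]
    rw [Fiber.eval_subst]
    refine TSS.ClosedProvable.rule hr (fun x => (T (M t) x).eval right) ?_
    rintro (⟨s, b, t'⟩ | ⟨s, b⟩) hl
    · obtain ⟨y, rfl, -⟩ := ntytt.1 s b t' hl
      exact solution (M t) s b y hl
    · have mem := neg_mem s b hl (Fiber.subst s (T (M t)))
      rw [Fiber.eval_subst] at mem
      exact .hyp mem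

theorem IsLift.exists_recur (hP : P.IsNtyftNtyxtWithRecursion) {V : Set Var}
    {S : V → Term Sg Var (PEmpty.{u + 1} ⊕ V)} {X : V} {a : A} {p' : ClosedTerm Sg Var}
    {Φ : Fiber left (Term.unfold V S X) → Fiber left p'}
    (hΦ : IsLift P N right Set.univ a Φ) :
    ∃ Ψ : Fiber left (Term.recur V S X) → Fiber left p',
      IsLift P N right {t | t.IsProper} a Ψ := by
  choose! body recur_body using fun (t : Fiber left (Term.recur V S X)) (ht : t.IsProper) =>
    Fiber.exists_recur_eq ht
  have body_bot : body ⊥ = ⊥ :=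
    (Fiber.recur X).injective (recur_body ⊥ Fiber.bot_isProper)
  refine ⟨fun t => Φ (Fiber.unfold X (body t)), ⟨fun t ht t' ht' hle => ?_, ?_, fun t ht => ?_⟩⟩
  · rw [← recur_body t ht, ← recur_body t' ht'] at hle
    exact hΦ.monotoneOn trivial trivial
      ((Fiber.unfold X).monotone ((Fiber.recur X).le_iff_le.1 hle))
  · rw [body_bot, Fiber.unfold_bot, hΦ.map_bot]
  · have unfolded := hΦ.provable (Fiber.unfold X (body t)) trivial
    rw [Fiber.eval_unfold] at unfolded
    nth_rewrite 1 [← recur_body t ht]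
    rw [Fiber.eval_recur]
    exact unfolded.recursion hP

theorem TSS.ClosedProvable.exists_isLift (hP : P.IsNtyftNtyxtWithRecursion)
    (isNeg : ∀ l ∈ N, l.IsNeg) (sim : P.Simulates N N' left right)
    (neg_mem : ∀ (t : ClosedTerm (Sg.adjoin L) Var) a,
      .neg (t.eval left) a ∈ N → .neg (t.eval right) a ∈ N')
    {p p' : ClosedTerm Sg Var} {a : A} (h : P.ClosedProvable N (.pos p a p')) :
    ∃ Φ : Fiber left p → Fiber left p', IsLift P N' right Set.univ a Φ := by
  generalize hl : Literal.pos p a p' = l at h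
  induction h generalizing p a p' with
  | hyp h =>
    cases hl
    exact (isNeg _ h).elim
  | @rule r hr σ premises ih =>
    cases hl
    suffices ∃ Φ : Fiber left (r.source.subst σ) → Fiber left (r.target.subst σ),
        IsLift P N' right {t | t.IsProper} r.label Φ by
      obtain ⟨Φ, hΦ⟩ := this
      exact hΦ.exists_univ sim (.rule hr σ premises)
    have lift_of_isFlat (ntytt : r.IsNtytt) (flat : r.source.IsFlat) :=
      exists_isLift_of_isNtytt hr ntytt flat (σ := σ) (fun s b y h => ih _ h rfl)
        fun s b h t => neg_mem t.1 b (t.2.symm ▸ (premises _ h).neg_mem)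
    rcases hP.2 r hr with ⟨V, S, X, a, z, rfl⟩ | ⟨ntytt, flat⟩ | ⟨ntytt, flat⟩
    · obtain ⟨Φ, hΦ⟩ := ih _ rfl (congrArg (Literal.pos · a (σ z)) (Term.subst_unfold V S X σ).symm)
      exact hΦ.exists_recur hP
    · exact lift_of_isFlat ntytt (Or.inr flat)
    · exact lift_of_isFlat ntytt (Or.inl flat)

theorem TSS.Simulates.eval (hP : P.IsNtyftNtyxtWithRecursion) (isNeg : ∀ l ∈ N, l.IsNeg)
    (sim : P.Simulates N N' left right)
    (neg_mem : ∀ (t : ClosedTerm (Sg.adjoin L) Var) a,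
      .neg (t.eval left) a ∈ N → .neg (t.eval right) a ∈ N') :
    P.Simulates N N' (fun t : ClosedTerm (Sg.adjoin L) Var => t.eval left)
      fun t => t.eval right := by
  intro t a p' h
  obtain ⟨Φ, hΦ⟩ := h.exists_isLift hP isNeg sim neg_mem
  exact ⟨(Φ ⟨t, rfl⟩).1, (Φ ⟨t, rfl⟩).2, hΦ.provable ⟨t, rfl⟩ trivial⟩

end Lift

namespace TSS

variable {Sg : Signature.{w}} {Var : Type u} {A : Type v} {P : TSS Sg Var A}

theorem Simulates.mono {N₁ N₂ N₁' N₂' : Set (Literal Sg Var A PEmpty.{u + 1})} {ι : Type*}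
    {left right : ι → ClosedTerm Sg Var} (sim : P.Simulates N₂ N₁' left right) (hN : N₁ ⊆ N₂)
    (hN' : N₁' ⊆ N₂') : P.Simulates N₁ N₂' left right := by
  intro i a p' h
  obtain ⟨j, hj, h'⟩ := sim i a p' (h.mono hN)
  exact ⟨j, hj, h'.mono hN'⟩

theorem consequences_mono (P : TSS Sg Var A) : Monotone P.consequences := by
  rintro N N' h (⟨p, a, q⟩ | ⟨p, a⟩) hβ
  · exact pos_mem_consequences.2 ((pos_mem_consequences.1 hβ).mono h)
  · exact hβ.1.elim

theorem undenied_antitone :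
    Antitone (undenied : Set (Literal Sg Var A PEmpty.{u + 1}) → Set _) :=
  fun _ _ h _ hl => ⟨hl.1, fun β hβ => hl.2 β (h hβ)⟩

theorem ctNeg_mono (P : TSS Sg Var A) : Monotone P.ctNeg :=
  fun _ _ h => undenied_antitone (P.consequences_mono (P.ptNeg_antitone h))

theorem neg_mem_undenied_consequences {N : Set (Literal Sg Var A PEmpty.{u + 1})}
    {p : ClosedTerm Sg Var} {a : A} :
    .neg p a ∈ undenied (P.consequences N) ↔ ∀ q, ¬ P.ClosedProvable N (.pos p a q) := by
  refine ⟨fun h q hq => h.2 _ (pos_mem_consequences.2 hq) ⟨rfl, rfl⟩, fun h => ⟨trivial, ?_⟩⟩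
  rintro (⟨q, b, q'⟩ | ⟨q, b⟩) hβ hd
  · obtain ⟨rfl, rfl⟩ := hd
    exact h _ (pos_mem_consequences.1 hβ)
  · exact hd

theorem Simulates.neg_mem_undenied {N N' : Set (Literal Sg Var A PEmpty.{u + 1})} {ι : Type*}
    {left right : ι → ClosedTerm Sg Var} (sim : P.Simulates N N' left right) {i : ι} {a : A}
    (h : .neg (right i) a ∈ undenied (P.consequences N')) :
    .neg (left i) a ∈ undenied (P.consequences N) := by
  rw [neg_mem_undenied_consequences] at h ⊢
  intro p' hp'
  obtain ⟨j, -, hj⟩ := sim i a p' hp'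
  exact h _ hj

theorem mem_ptNeg {o : Ordinal.{max (u + 1) v w}} {l : Literal Sg Var A PEmpty.{u + 1}} :
    l ∈ P.ptNeg o ↔ l.IsNeg ∧ ∀ k < o, l ∈ undenied (P.consequences (P.ctNeg k)) := by
  simp only [← ctPos_eq]
  exact ⟨fun h => ⟨h.1, fun k hk => ⟨h.1, fun β hβ => h.2 β ⟨k, hk, hβ⟩⟩⟩,
    fun h => ⟨h.1, fun β ⟨k, hk, hβ⟩ => (h.2 k hk).2 β hβ⟩⟩

theorem ptNeg_closureOrdinal_subset (P : TSS Sg Var A) :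
    P.ptNeg P.closureOrdinal ⊆ undenied (P.consequences (P.ctNeg P.closureOrdinal)) := by
  have closure : P.IsClosureOrdinal P.closureOrdinal :=
    Classical.choose_spec P.exists_isClosureOrdinal
  intro l hl
  rw [← closure _ (Order.lt_succ _)] at hl
  exact (mem_ptNeg.1 hl).2 _ (Order.lt_succ _)

/-- Negative premises relate the stages crosswise: a failure of certain transitions at stage `o` is
traced back to possible transitions at stage `o`, and a failure of those to certain transitions at
earlier stages. -/
theorem simulates_eval {L : Type z} {left right : L → ClosedTerm Sg Var}
    (hP : P.IsNtyftNtyxtWithRecursion)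
    (certain : P.Simulates (P.ctNeg P.closureOrdinal) (P.ctNeg P.closureOrdinal) left right)
    (possible : P.Simulates (P.ptNeg P.closureOrdinal) (P.ptNeg P.closureOrdinal) right left)
    (o : Ordinal.{max (u + 1) v w}) (ho : o ≤ P.closureOrdinal) :
    P.Simulates (P.ctNeg o) (P.ctNeg P.closureOrdinal)
        (fun t : ClosedTerm (Sg.adjoin L) Var => t.eval left) (fun t => t.eval right) ∧
      P.Simulates (P.ptNeg P.closureOrdinal) (P.ptNeg o)
        (fun t : ClosedTerm (Sg.adjoin L) Var => t.eval right) (fun t => t.eval left) := by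
  induction o using WellFoundedLT.induction with
  | ind o ih =>
    have possible_stage : P.Simulates (P.ptNeg P.closureOrdinal) (P.ptNeg o)
        (fun t : ClosedTerm (Sg.adjoin L) Var => t.eval right) fun t => t.eval left :=
      .eval hP (fun _ h => h.1) (possible.mono subset_rfl (P.ptNeg_antitone ho)) fun t a h =>
        mem_ptNeg.2 ⟨trivial, fun k hk =>
          (ih k hk (hk.le.trans ho)).1.neg_mem_undenied (i := t) (P.ptNeg_closureOrdinal_subset h)⟩
    exact ⟨.eval hP (fun _ h => h.1) (certain.mono (P.ctNeg_mono ho) subset_rfl) fun t _ h =>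
      possible_stage.neg_mem_undenied (i := t) h, possible_stage⟩

theorem certain_iff {p q : ClosedTerm Sg Var} {a : A} :
    P.Certain p a q ↔ P.ClosedProvable (P.ctNeg P.closureOrdinal) (.pos p a q) := by
  rw [Certain, ctPos_eq, pos_mem_consequences]

theorem possible_iff {p q : ClosedTerm Sg Var} {a : A} :
    P.Possible p a q ↔ P.ClosedProvable (P.ptNeg P.closureOrdinal) (.pos p a q) := by
  rw [Possible, ptPos, pos_mem_consequences]

end TSS

/-- The lean congruence closure of a relation: it relates two closed terms if the second arises from
the first by replacing closed subterms by related ones. The terms in between have the related pairs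
as constants. -/
def SubstClosure {Sg : Signature.{w}} {Var : Type u}
    (B : ClosedTerm Sg Var → ClosedTerm Sg Var → Prop) (p q : ClosedTerm Sg Var) : Prop :=
  ∃ t : ClosedTerm (Sg.adjoin {x : ClosedTerm Sg Var × ClosedTerm Sg Var // B x.1 x.2}) Var,
    t.eval (fun l => l.1.1) = p ∧ t.eval (fun l => l.1.2) = q

theorem SubstClosure.of_subst {Sg : Signature.{w}} {Var W : Type u}
    {B : ClosedTerm Sg Var → ClosedTerm Sg Var → Prop} (t : Term Sg Var W)
    {ρ ν : W → ClosedTerm Sg Var} (h : ∀ x, B (ρ x) (ν x)) :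
    SubstClosure B (t.subst ρ) (t.subst ν) := by
  refine ⟨(t.embed _).subst fun x => .const ⟨(ρ x, ν x), h x⟩, ?_, ?_⟩ <;>
    simp only [Term.eval_subst, Term.eval_embed, Term.eval_const, Term.ofClosed_eq_self]

namespace TSS

variable {Sg : Signature.{w}} {Var : Type u} {A : Type v} {P : TSS Sg Var A}

theorem IsBisimulation.substClosure (hP : P.IsNtyftNtyxtWithRecursion)
    {B : ClosedTerm Sg Var → ClosedTerm Sg Var → Prop} (hB : P.IsBisimulation B) :
    P.IsBisimulation (SubstClosure B) := by
  obtain ⟨certain, possible⟩ := simulates_eval hP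
    (left := fun l : {x : ClosedTerm Sg Var × ClosedTerm Sg Var // B x.1 x.2} => l.1.1)
    (right := fun l => l.1.2)
    (fun l a p' h => by
      obtain ⟨q', hq', hB'⟩ := hB.certain _ _ a p' l.2 (certain_iff.2 h)
      exact ⟨⟨(p', q'), hB'⟩, rfl, certain_iff.1 hq'⟩)
    (fun l a q' h => by
      obtain ⟨p', hp', hB'⟩ := hB.possible _ _ a q' l.2 (possible_iff.2 h)
      exact ⟨⟨(p', q'), hB'⟩, rfl, possible_iff.1 hp'⟩)
    P.closureOrdinal le_rfl
  constructor
  · rintro _ _ a p' ⟨t, rfl, rfl⟩ h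
    obtain ⟨t', ht', h'⟩ := certain t a p' (certain_iff.1 h)
    exact ⟨_, certain_iff.2 h', t', ht', rfl⟩
  · rintro _ _ a q' ⟨t, rfl, rfl⟩ h
    obtain ⟨t', ht', h'⟩ := possible t a q' (possible_iff.1 h)
    exact ⟨_, possible_iff.2 h', t', rfl, ht'⟩

theorem isBisimulation_eq (P : TSS Sg Var A) : P.IsBisimulation Eq where
  certain := by
    rintro p _ a p' rfl h
    exact ⟨p', h, rfl⟩
  possible := by
    rintro p _ a p' rfl h
    exact ⟨p', h, rfl⟩

theorem IsBisimulation.comp {R R' : ClosedTerm Sg Var → ClosedTerm Sg Var → Prop}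
    (hR : P.IsBisimulation R) (hR' : P.IsBisimulation R') :
    P.IsBisimulation (Relation.Comp R R') where
  certain := by
    rintro p s a p' ⟨q, hpq, hqs⟩ h
    obtain ⟨q', hq', hp'q'⟩ := hR.certain p q a p' hpq h
    obtain ⟨s', hs', hq's'⟩ := hR'.certain q s a q' hqs hq'
    exact ⟨s', hs', q', hp'q', hq's'⟩
  possible := by
    rintro p s a s' ⟨q, hpq, hqs⟩ h
    obtain ⟨q', hq', hq's'⟩ := hR'.possible q s a s' hqs h
    obtain ⟨p', hp', hp'q'⟩ := hR.possible p q a q' hpq hq'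
    exact ⟨p', hp', q', hp'q', hq's'⟩

theorem isBisimulation_bisimPreorder (P : TSS Sg Var A) : P.IsBisimulation P.BisimPreorder where
  certain := by
    rintro p q a p' ⟨R, hR, hpq⟩ h
    obtain ⟨q', hq', hp'q'⟩ := hR.certain p q a p' hpq h
    exact ⟨q', hq', R, hR, hp'q'⟩
  possible := by
    rintro p q a q' ⟨R, hR, hpq⟩ h
    obtain ⟨p', hp', hp'q'⟩ := hR.possible p q a q' hpq h
    exact ⟨p', hp', R, hR, hp'q'⟩

end TSS

theorem mainTheorem1 {Sg : Signature.{w}} {Var : Type u} {A : Type v} (P : TSS Sg Var A)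
    (hP : P.IsNtyftNtyxtWithRecursion) : IsLeanPrecongruence P.BisimPreorder where
  refl _ := ⟨Eq, P.isBisimulation_eq, rfl⟩
  trans _ q _ := fun ⟨_, hR, hpq⟩ ⟨_, hR', hqs⟩ => ⟨_, hR.comp hR', q, hpq, hqs⟩
  lean t _ _ h :=
    ⟨SubstClosure P.BisimPreorder, P.isBisimulation_bisimPreorder.substClosure hP,
      SubstClosure.of_subst t h⟩
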